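/- For a finite simple graph $G$, let $\chi_\ell(G)$ denote its list chromatic number, i.e. the least $k$ such that for every assignment of sets $L(v)\subseteq\mathbb{N}$ with $|L(v)|\ge k$ to the vertices $v$ of $G$ there is a proper colouring $c$ of $G$ with $c(v)\in L(v)$ for every vertex $v$. Then for every $\varepsilon>0$ there exists $f_0=f_0(\varepsilon)$ such that the following holds for every real $f\ge f_0$. Let $G$ be a finite simple graph of maximum degree $\Delta$, where $1\le f\le \Delta^2+1$, such that for every vertex $v$ the subgraph of $G$ induced by the neighbourhood $N(v)$ has at most $\Delta^2/f$ edges. Then \[ \chi_\ell(G)\;\le\;(1+\varepsilon)\,\frac{\Delta}{\ln\min\{\Delta,f\}} . \] (In other words, $\chi_\ell(G)\le(1+o(1))\,\Delta/\ln\min\{\Delta,f\}$ as $f\to\infty$, where the $o(1)$ term depends only on $f$.) -/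

import Mathlib

namespace SimpleGraph

/-- `G` is `L`-colourable: there is a proper colouring `c` of `G` with `c v ∈ L v` for all `v`. -/
def IsListColorable {V : Type*} (G : SimpleGraph V) (L : V → Set ℕ) : Prop :=
  ∃ c : V → ℕ, (∀ v, c v ∈ L v) ∧ ∀ u v, G.Adj u v → c u ≠ c v

/-- `G` is `L`-colourable for every list-assignment `L` whose lists (finite or infinite)
all have at least `k` elements. -/
def IsChoosable {V : Type*} (G : SimpleGraph V) (k : ℕ) : Prop :=
  ∀ L : V → Set ℕ, (∀ v, (k : ℕ∞) ≤ (L v).encard) → G.IsListColorable L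

/-- The list chromatic number: the least `k` such that `G` is `L`-colourable for every
list-assignment `L` with lists of size at least `k` (and `⊤` if there is no such `k`). -/
noncomputable def listChromaticNumber {V : Type*} (G : SimpleGraph V) : ℕ∞ :=
  ⨅ (k : ℕ) (_ : G.IsChoosable k), (k : ℕ∞)

end SimpleGraph

/-! A counting induction shows that adding a vertex `v` to any set `S` multiplies the number of
proper `L`-colourings by at least `l > 0`; hence the whole graph has a colouring. Take a uniform
colouring of `S`. By induction, a fixed `u ∈ S` has at most `t` colours left with probability at
most `t / l` (`mul_card_available_le`). Few neighbours of `v` have more than `d` neighbours inside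
the sparse neighbourhood, so by Markov's inequality at least half of the colourings have at most `δ
* q` bad neighbours.

For such a colouring, keep the colours of the non-neighbours and bad neighbours of `v`, and resample
the rest. Each resampled `u` has many free colours and few resampled neighbours, so a given colour
is taken by `u` with probability about one over its number of free colours, even when other vertices
are known to avoid that colour (`mul_card_extensions_apply_eq_le`). Multiplying over `u` and
averaging over colours by convexity leaves at least `(1 - δ) * q * exp (-m)` colours at `v` on
average. This beats `2 * l` once `q` exceeds `Δ / log F` by a constant factor. -/

namespace SimpleGraph

open Finset Function

/-! ### Counting partial list colourings -/

section Counting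

variable {V : Type*} (G : SimpleGraph V) [DecidableRel G.Adj]
  (L : V → Finset ℕ)

/-- The colours of `L v` that `c` does not use on the neighbours of `v` in `S`. -/
def available (S : Finset V) (c : V → ℕ) (v : V) : Finset ℕ :=
  {x ∈ L v | ∀ u ∈ S, G.Adj v u → c u ≠ x}

variable {G L}

theorem mem_available {S : Finset V} {c : V → ℕ} {v : V} {x : ℕ} :
    x ∈ G.available L S c v ↔ x ∈ L v ∧ ∀ u ∈ S, G.Adj v u → c u ≠ x := by
  simp [available]

theorem available_congr {S : Finset V} {c c' : V → ℕ} (h : ∀ u ∈ S, c u = c' u) (v : V) :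
    G.available L S c v = G.available L S c' v := by
  ext x
  simp only [mem_available]
  exact and_congr_right fun _ => forall₂_congr fun u hu => by rw [h u hu]

theorem available_anti {S T : Finset V} (h : S ⊆ T) (c : V → ℕ) (v : V) :
    G.available L T c v ⊆ G.available L S c v := by
  intro x
  simp only [mem_available]
  exact fun hx => ⟨hx.1, fun u hu => hx.2 u (h hu)⟩

variable [DecidableEq V]

theorem card_available_le_union (S T : Finset V) (c : V → ℕ) (v : V) :
    #(G.available L S c v) ≤ #(G.available L (S ∪ T) c v) + #{u ∈ T | G.Adj v u} := by
  have h : G.available L S c v ⊆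
      G.available L (S ∪ T) c v ∪ ({u ∈ T | G.Adj v u} : Finset V).image c := by
    intro x
    simp only [mem_available, mem_union, mem_image, mem_filter]
    rintro ⟨hx, hS⟩
    by_cases hT : ∃ a, (a ∈ T ∧ G.Adj v a) ∧ c a = x
    · exact Or.inr hT
    · push Not at hT
      refine Or.inl ⟨hx, ?_⟩
      rintro u (hu | hu) ha
      · exact hS u hu ha
      · exact hT u ⟨hu, ha⟩
  calc _ ≤ _ := card_le_card h
    _ ≤ _ := card_union_le _ _
    _ ≤ _ := Nat.add_le_add_left card_image_le _

variable [Fintype V]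

variable (G L) in
/-- The proper `L`-colourings of the subgraph induced by `S`, extended by `0` outside `S`. -/
def partialColorings (S : Finset V) : Finset (V → ℕ) :=
  {c ∈ Fintype.piFinset (fun u => if u ∈ S then L u else {0}) |
    ∀ u ∈ S, ∀ w ∈ S, G.Adj u w → c u ≠ c w}

theorem mem_partialColorings {S : Finset V} {c : V → ℕ} :
    c ∈ G.partialColorings L S ↔ (∀ u ∈ S, c u ∈ L u) ∧ (∀ u ∉ S, c u = 0) ∧
      ∀ u ∈ S, ∀ w ∈ S, G.Adj u w → c u ≠ c w := by
  simp only [partialColorings, mem_filter, Fintype.mem_piFinset, ← and_assoc]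
  refine and_congr_left fun _ => ⟨fun h => ⟨fun u hu => ?_, fun u hu => ?_⟩, fun h u => ?_⟩
  · simpa [hu] using h u
  · simpa [hu] using h u
  · by_cases hu : u ∈ S
    · simpa [hu] using h.1 u hu
    · simpa [hu] using h.2 u hu

theorem update_mem_partialColorings {S : Finset V} {v : V} (hv : v ∉ S) {c : V → ℕ} {x : ℕ}
    (hc : c ∈ G.partialColorings L S) (hx : x ∈ G.available L S c v) :
    update c v x ∈ G.partialColorings L (insert v S) := by
  rw [mem_partialColorings] at hc ⊢
  rw [mem_available] at hx
  have hne : ∀ u ∈ S, u ≠ v := fun u hu h => hv (h ▸ hu)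
  refine ⟨fun u hu => ?_, fun u hu => ?_, fun u hu w hw ha => ?_⟩
  · rcases mem_insert.1 hu with rfl | hu
    · simpa using hx.1
    · simpa [hne u hu] using hc.1 u hu
  · rw [mem_insert, not_or] at hu
    simpa [hu.1] using hc.2.1 u hu.2
  · rcases mem_insert.1 hu with rfl | hu' <;> rcases mem_insert.1 hw with rfl | hw'
    · exact absurd ha (G.loopless.irrefl _)
    · simpa [hne w hw'] using (hx.2 w hw' ha).symm
    · simpa [hne u hu'] using hx.2 u hu' ha.symm
    · simpa [hne u hu', hne w hw'] using hc.2.2 u hu' w hw' ha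

theorem update_zero_mem_partialColorings {S : Finset V} {v : V} (hv : v ∉ S) {c : V → ℕ}
    (hc : c ∈ G.partialColorings L (insert v S)) :
    update c v 0 ∈ G.partialColorings L S := by
  rw [mem_partialColorings] at hc ⊢
  have hne : ∀ u ∈ S, u ≠ v := fun u hu h => hv (h ▸ hu)
  refine ⟨fun u hu => ?_, fun u hu => ?_, fun u hu w hw ha => ?_⟩
  · simpa [hne u hu] using hc.1 u (mem_insert_of_mem hu)
  · by_cases h : u = v
    · simp [h]
    · simpa [h] using hc.2.1 u (by simp [h, hu])
  · simpa [hne u hu, hne w hw] using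
      hc.2.2 u (mem_insert_of_mem hu) w (mem_insert_of_mem hw) ha

theorem apply_mem_available {S T : Finset V} {v : V} (hv : v ∈ S) (hT : T ⊆ S) {c : V → ℕ}
    (hc : c ∈ G.partialColorings L S) : c v ∈ G.available L T c v := by
  rw [mem_partialColorings] at hc
  exact mem_available.2 ⟨hc.1 v hv, fun u hu ha => hc.2.2 u (hT hu) v hv ha.symm⟩

/-- Colourings of `insert v S` are colourings of `S` with a choice of an available colour at `v`. -/
theorem card_partialColorings_insert {S : Finset V} {v : V} (hv : v ∉ S) (P : (V → ℕ) → Prop)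
    [DecidablePred P] (hP : ∀ c x, P (update c v x) ↔ P c) :
    #{c ∈ G.partialColorings L (insert v S) | P c} =
      ∑ c ∈ G.partialColorings L S with P c, #(G.available L S c v) := by
  rw [← card_sigma]
  have hne : ∀ u ∈ S, u ≠ v := fun u hu h => hv (h ▸ hu)
  refine card_nbij' (fun c => ⟨update c v 0, c v⟩) (fun p => update p.1 v p.2) ?_ ?_ ?_ ?_
  · intro c hc
    simp only [coe_filter, Set.mem_ofPred_eq] at hc
    simp only [coe_sigma, Set.mem_sigma_iff, mem_coe, mem_filter, hP]
    refine ⟨⟨update_zero_mem_partialColorings hv hc.1, hc.2⟩, ?_⟩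
    rw [available_congr (c' := c) fun u hu => by simp [hne u hu]]
    exact apply_mem_available (mem_insert_self _ _) (subset_insert _ _) hc.1
  · rintro ⟨c, x⟩ hc
    simp only [coe_sigma, Set.mem_sigma_iff, mem_coe, mem_filter] at hc
    simp only [coe_filter, Set.mem_ofPred_eq, hP]
    exact ⟨update_mem_partialColorings hv hc.1.1 hc.2, hc.1.2⟩
  · intro c _
    simp
  · rintro ⟨c, x⟩ hc
    simp only [coe_sigma, Set.mem_sigma_iff, mem_coe, mem_filter] at hc
    have h0 := (mem_partialColorings.1 hc.1.1).2.1 v hv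
    simp [← h0]

/-- If deleting `u` divides the number of colourings by at least `l`, then few colourings leave
at most `t` colours available at `u`. -/
theorem mul_card_available_le {S : Finset V} {u : V} (hu : u ∈ S) {l t : ℝ} (hl : 0 ≤ l)
    (ht : 0 ≤ t) (h : l * #(G.partialColorings L (S.erase u)) ≤ #(G.partialColorings L S)) :
    l * #{c ∈ G.partialColorings L S | (#(G.available L (S.erase u) c u) : ℝ) ≤ t} ≤
      t * #(G.partialColorings L S) := by
  -- The condition ignores the colour at `u`, so each colouring of `S.erase u` satisfying it
  -- accounts for at most `t` colourings of `S`.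
  have key := card_partialColorings_insert (G := G) (L := L) (notMem_erase u S)
    (fun c => (#(G.available L (S.erase u) c u) : ℝ) ≤ t) (fun c x => by
      rw [available_congr (c' := c) fun w hw => by simp [ne_of_mem_erase hw]])
  rw [insert_erase hu] at key
  rw [key]
  have h2 : ((∑ c ∈ G.partialColorings L (S.erase u) with
      (#(G.available L (S.erase u) c u) : ℝ) ≤ t, #(G.available L (S.erase u) c u) : ℕ) : ℝ) ≤
      t * #(G.partialColorings L (S.erase u)) := by
    push_cast
    calc _ ≤ ∑ c ∈ G.partialColorings L (S.erase u) with
          (#(G.available L (S.erase u) c u) : ℝ) ≤ t, t :=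
          sum_le_sum fun c hc => (mem_filter.1 hc).2
      _ = #{c ∈ G.partialColorings L (S.erase u) |
          (#(G.available L (S.erase u) c u) : ℝ) ≤ t} * t := by rw [sum_const, nsmul_eq_mul]
      _ ≤ #(G.partialColorings L (S.erase u)) * t := by
          gcongr
          exact filter_subset _ _
      _ = _ := mul_comm _ _
  calc _ ≤ l * (t * #(G.partialColorings L (S.erase u))) := by gcongr
    _ = t * (l * #(G.partialColorings L (S.erase u))) := by ring
    _ ≤ _ := by gcongr

end Counting

/-- Jensen's inequality for the convex function `exp (-·)`, proved by its tangent line at `m`. -/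
theorem card_mul_exp_neg_le_sum_exp_neg {ι : Type*} (X : Finset ι) (a : ι → ℝ) {m : ℝ}
    (h : ∑ x ∈ X, a x ≤ m * #X) : #X * Real.exp (-m) ≤ ∑ x ∈ X, Real.exp (-a x) := by
  have h1 : ∀ x ∈ X, Real.exp (-m) * (1 + m - a x) ≤ Real.exp (-a x) := by
    intro x _
    have := Real.add_one_le_exp (m - a x)
    calc _ ≤ Real.exp (-m) * Real.exp (m - a x) := by gcongr; linarith
      _ = _ := by rw [← Real.exp_add]; ring_nf
  calc _ ≤ Real.exp (-m) * (#X + (m * #X - ∑ x ∈ X, a x)) := by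
        rw [mul_comm]; gcongr; linarith
    _ = ∑ x ∈ X, Real.exp (-m) * (1 + m - a x) := by
        rw [← mul_sum, sum_sub_distrib, sum_const, nsmul_eq_mul]; ring
    _ ≤ _ := sum_le_sum h1

/-! ### Resampling the colours outside a fixed set -/

section Extensions

variable {V : Type*} {G : SimpleGraph V} [DecidableRel G.Adj] {L : V → Finset ℕ} [DecidableEq V]
  [Fintype V]

variable (G L) in
/-- The proper `L`-colourings of the subgraph induced by `S` that agree with `c₀` on `T`. -/
def extensions (S T : Finset V) (c₀ : V → ℕ) : Finset (V → ℕ) :=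
  {c ∈ G.partialColorings L S | ∀ u ∈ T, c u = c₀ u}

theorem mem_extensions {S T : Finset V} {c₀ c : V → ℕ} :
    c ∈ G.extensions L S T c₀ ↔ c ∈ G.partialColorings L S ∧ ∀ u ∈ T, c u = c₀ u := by
  simp [extensions]

theorem recolor_mem_partialColorings {S : Finset V} {u : V} (hu : u ∈ S) {c : V → ℕ} {y : ℕ}
    (hc : c ∈ G.partialColorings L S) (hy : y ∈ G.available L (S.erase u) c u) :
    update c u y ∈ G.partialColorings L S := by
  have h1 := update_zero_mem_partialColorings (G := G) (L := L) (c := c) (notMem_erase u S)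
    (by rwa [insert_erase hu])
  have h2 := update_mem_partialColorings (x := y) (notMem_erase u S) h1 (by
    rwa [available_congr (c' := c) fun w hw => by simp [ne_of_mem_erase hw]])
  rwa [insert_erase hu, update_idem] at h2

/-- Recolouring `u` in all possible ways bounds the number of extensions with colour `x` at `u`,
also when colour `x` is forbidden on another set `D`. -/
theorem mul_card_extensions_apply_eq_le {S T D : Finset V} {c₀ : V → ℕ} {u : V} {x : ℕ} {d : ℝ}
    (hTS : T ⊆ S) (hu : u ∈ S \ T) (huD : u ∉ D) (hd : (#{w ∈ S \ T | G.Adj u w} : ℝ) ≤ d) :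
    (#(G.available L T c₀ u) - d) *
        #{c ∈ G.extensions L S T c₀ | (∀ w ∈ D, c w ≠ x) ∧ c u = x} ≤
      #{c ∈ G.extensions L S T c₀ | ∀ w ∈ D, c w ≠ x} := by
  obtain ⟨huS, huT⟩ := mem_sdiff.1 hu
  set Φ := G.extensions L S T c₀ with hΦ
  set P := {c ∈ Φ | (∀ w ∈ D, c w ≠ x) ∧ c u = x} with hP
  -- Double counting along `c ↦ update c u x`: the fibres are disjoint, and the fibre over `p ∈ P`
  -- contains every valid recolouring of `p` at `u`.
  have hsum : ∑ p ∈ P, #{c ∈ {c ∈ Φ | ∀ w ∈ D, c w ≠ x} | update c u x = p} ≤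
      #{c ∈ Φ | ∀ w ∈ D, c w ≠ x} := by
    rw [sum_card_fiberwise_eq_card_filter]
    exact card_le_card (filter_subset _ _)
  have hfib : ∀ p ∈ P, (#(G.available L T c₀ u) - d : ℝ) ≤
      #{c ∈ {c ∈ Φ | ∀ w ∈ D, c w ≠ x} | update c u x = p} := by
    intro p hp
    obtain ⟨hpΦ, hpD, hpx⟩ := mem_filter.1 hp
    obtain ⟨hpS, hpT⟩ := mem_extensions.1 hpΦ
    have h1 : #(G.available L (S.erase u) p u) ≤
        #{c ∈ {c ∈ Φ | ∀ w ∈ D, c w ≠ x} | update c u x = p} := by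
      refine card_le_card_of_injOn (fun y => update p u y) ?_ ?_
      · intro y hy
        simp only [coe_filter, Set.mem_ofPred_eq, mem_filter, update_idem]
        refine ⟨⟨mem_extensions.2 ⟨recolor_mem_partialColorings huS hpS hy, fun w hw => ?_⟩,
          fun w hw => ?_⟩, by rw [← hpx, update_eq_self]⟩
        · rw [update_of_ne (ne_of_mem_of_not_mem hw huT), hpT w hw]
        · rw [update_of_ne (ne_of_mem_of_not_mem hw huD)]
          exact hpD w hw
      · intro y _ z _ h
        exact update_injective p u h
    have h2 := card_available_le_union (G := G) (L := L) T ((S \ T).erase u) p u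
    have h3 : T ∪ (S \ T).erase u = S.erase u := by
      ext w
      simp only [mem_union, mem_erase, mem_sdiff]
      constructor
      · rintro (h | h)
        · exact ⟨fun e => huT (e ▸ h), hTS h⟩
        · exact ⟨h.1, h.2.1⟩
      · rintro ⟨h1, h2⟩
        tauto
    have h4 : #{w ∈ (S \ T).erase u | G.Adj u w} ≤ #{w ∈ S \ T | G.Adj u w} :=
      card_le_card (filter_subset_filter _ (erase_subset _ _))
    rw [h3, available_congr hpT] at h2
    have h5 : (#(G.available L T c₀ u) : ℝ) ≤
        #{c ∈ {c ∈ Φ | ∀ w ∈ D, c w ≠ x} | update c u x = p} + #{w ∈ S \ T | G.Adj u w} := by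
      exact_mod_cast h2.trans (add_le_add h1 h4)
    linarith
  calc _ = ∑ p ∈ P, (#(G.available L T c₀ u) - d : ℝ) := by
        rw [sum_const, nsmul_eq_mul, mul_comm]
    _ ≤ ∑ p ∈ P, (#{c ∈ {c ∈ Φ | ∀ w ∈ D, c w ≠ x} | update c u x = p} : ℝ) :=
        sum_le_sum hfib
    _ ≤ _ := by exact_mod_cast hsum

/-- Most extensions avoid the colour `x` on `D`, as seen by recolouring one vertex at a time. -/
theorem exp_mul_card_extensions_le {S T : Finset V} {c₀ : V → ℕ} {x : ℕ} {d β : ℝ}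
    (hTS : T ⊆ S) (hdeg : ∀ u ∈ S \ T, (#{w ∈ S \ T | G.Adj u w} : ℝ) ≤ d)
    (hlt : ∀ u ∈ S \ T, d < #(G.available L T c₀ u))
    (hβ : ∀ u ∈ S \ T, Real.exp (-(β / #(G.available L T c₀ u))) ≤
      1 - 1 / (#(G.available L T c₀ u) - d)) (D : Finset V) (hD : D ⊆ S \ T) :
    Real.exp (-∑ u ∈ D with x ∈ G.available L T c₀ u, β / #(G.available L T c₀ u)) *
      #(G.extensions L S T c₀) ≤ #{c ∈ G.extensions L S T c₀ | ∀ w ∈ D, c w ≠ x} := by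
  induction D using Finset.induction_on with
  | empty => simp
  | insert u D huD ih =>
    have hu : u ∈ S \ T := hD (mem_insert_self _ _)
    specialize ih ((subset_insert _ _).trans hD)
    have hsplit : #{c ∈ G.extensions L S T c₀ | ∀ w ∈ D, c w ≠ x} =
        #{c ∈ G.extensions L S T c₀ | (∀ w ∈ D, c w ≠ x) ∧ c u = x} +
        #{c ∈ G.extensions L S T c₀ | ∀ w ∈ insert u D, c w ≠ x} := by
      rw [← card_filter_add_card_filter_not (s := {c ∈ G.extensions L S T c₀ | ∀ w ∈ D, c w ≠ x})
        (fun c => c u = x), filter_filter, filter_filter]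
      simp [and_comm]
    rw [filter_insert]
    split_ifs with hx
    · have h1 := mul_card_extensions_apply_eq_le (c₀ := c₀) (L := L) (x := x) hTS hu huD (hdeg u hu)
      have h2 := hβ u hu
      have h3 := hlt u hu
      set n : ℝ := (#(G.available L T c₀ u) : ℝ)
      rw [sum_insert (by simp [huD]), neg_add, Real.exp_add, mul_assoc]
      set M := Real.exp (-∑ u ∈ D with x ∈ G.available L T c₀ u, β / #(G.available L T c₀ u)) *
        #(G.extensions L S T c₀)
      have h4 : (#{c ∈ G.extensions L S T c₀ | (∀ w ∈ D, c w ≠ x) ∧ c u = x} : ℝ) ≤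
          1 / (n - d) * #{c ∈ G.extensions L S T c₀ | ∀ w ∈ D, c w ≠ x} := by
        rw [one_div, ← div_eq_inv_mul, le_div_iff₀ (by linarith), mul_comm]
        exact h1
      have hsplit' : (#{c ∈ G.extensions L S T c₀ | ∀ w ∈ D, c w ≠ x} : ℝ) =
        #{c ∈ G.extensions L S T c₀ | (∀ w ∈ D, c w ≠ x) ∧ c u = x} +
        #{c ∈ G.extensions L S T c₀ | ∀ w ∈ insert u D, c w ≠ x} := by exact_mod_cast hsplit
      calc _ ≤ Real.exp (-(β / n)) * #{c ∈ G.extensions L S T c₀ | ∀ w ∈ D, c w ≠ x} := by gcongr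
        _ ≤ (1 - 1 / (n - d)) * #{c ∈ G.extensions L S T c₀ | ∀ w ∈ D, c w ≠ x} := by gcongr
        _ ≤ _ := by linarith
    -- Here `x` is already blocked at `u`, so avoiding it there costs nothing.
    · refine ih.trans ?_
      have h0 : #{c ∈ G.extensions L S T c₀ | (∀ w ∈ D, c w ≠ x) ∧ c u = x} = 0 := by
        rw [card_eq_zero, filter_eq_empty_iff]
        rintro c hc ⟨-, rfl⟩
        obtain ⟨hcS, hcT⟩ := mem_extensions.1 hc
        apply hx
        rw [← available_congr hcT]
        exact apply_mem_available (mem_sdiff.1 hu).1 hTS hcS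
      rw [hsplit, h0, zero_add]

/-- On average, the extensions of a colouring leave many colours available at `v`. -/
theorem mul_card_extensions_le_sum_available {S T : Finset V} {c₀ : V → ℕ} {d β m : ℝ} {v : V}
    (hTS : T ⊆ S) (hdeg : ∀ u ∈ S \ T, (#{w ∈ S \ T | G.Adj u w} : ℝ) ≤ d)
    (hlt : ∀ u ∈ S \ T, d < #(G.available L T c₀ u))
    (hexp : ∀ u ∈ S \ T, Real.exp (-(β / #(G.available L T c₀ u))) ≤
      1 - 1 / (#(G.available L T c₀ u) - d)) (hβ : 0 ≤ β)
    (hm : β * #(S \ T) ≤ m * #(G.available L T c₀ v)) :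
    #(G.available L T c₀ v) * Real.exp (-m) * #(G.extensions L S T c₀) ≤
      ∑ c ∈ G.extensions L S T c₀, (#(G.available L S c v) : ℝ) := by
  set X := G.available L T c₀ v with hX
  set a : ℕ → ℝ := fun x =>
    ∑ u ∈ S \ T with x ∈ G.available L T c₀ u, β / #(G.available L T c₀ u) with ha
  have hsum : ∑ x ∈ X, a x ≤ m * #X := by
    refine le_trans ?_ hm
    calc ∑ x ∈ X, a x = ∑ u ∈ S \ T, ∑ x ∈ X,
          if x ∈ G.available L T c₀ u then β / #(G.available L T c₀ u) else 0 := by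
          simp only [ha, sum_filter]
          exact sum_comm
      -- Each `u` spreads total weight at most `β` over its available colours.
      _ ≤ ∑ u ∈ S \ T, β := by
          refine sum_le_sum fun u hu => ?_
          rw [← sum_filter, sum_const, nsmul_eq_mul]
          have h1 : #{x ∈ X | x ∈ G.available L T c₀ u} ≤ #(G.available L T c₀ u) :=
            card_le_card fun x hx => (mem_filter.1 hx).2
          rcases Nat.eq_zero_or_pos #(G.available L T c₀ u) with h0 | h0
          · simpa [h0] using hβ
          · rw [mul_div_assoc', div_le_iff₀ (by exact_mod_cast h0), mul_comm]
            gcongr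
      _ = _ := by rw [sum_const, nsmul_eq_mul, mul_comm]
  have hcount : ∑ x ∈ X, #{c ∈ G.extensions L S T c₀ | ∀ w ∈ S \ T, c w ≠ x} ≤
      ∑ c ∈ G.extensions L S T c₀, #(G.available L S c v) := by
    simp only [card_filter]
    rw [sum_comm]
    refine sum_le_sum fun c hc => ?_
    rw [← card_filter]
    refine card_le_card fun x hx => ?_
    obtain ⟨hxX, hxc⟩ := mem_filter.1 hx
    rw [hX, mem_available] at hxX
    refine mem_available.2 ⟨hxX.1, fun u hu hadj => ?_⟩
    by_cases huT : u ∈ T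
    · rw [(mem_extensions.1 hc).2 u huT]
      exact hxX.2 u huT hadj
    · exact hxc u (mem_sdiff.2 ⟨hu, huT⟩)
  calc _ ≤ (∑ x ∈ X, Real.exp (-a x)) * #(G.extensions L S T c₀) := by
        gcongr
        exact card_mul_exp_neg_le_sum_exp_neg X a hsum
    _ = ∑ x ∈ X, Real.exp (-a x) * #(G.extensions L S T c₀) := by rw [sum_mul]
    _ ≤ ∑ x ∈ X, (#{c ∈ G.extensions L S T c₀ | ∀ w ∈ S \ T, c w ≠ x} : ℝ) :=
        sum_le_sum fun x _ => exp_mul_card_extensions_le hTS hdeg hlt hexp _ subset_rfl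
    _ ≤ _ := by exact_mod_cast hcount

end Extensions

/-! ### Bad neighbours and the inductive step -/

section Induction

variable {V : Type*} {G : SimpleGraph V} [DecidableRel G.Adj] {L : V → Finset ℕ}

variable (G L) in
/-- The neighbours of `v` in `S` that have more than `d` common neighbours with `v` in `S`, or at
most `t` colours left by the colouring `c` of the non-neighbours of `v` in `S`. -/
noncomputable def badNeighbors (S : Finset V) (v : V) (d t : ℝ) (c : V → ℕ) : Finset V :=
  {u ∈ {u ∈ S | G.Adj v u} | d < #{w ∈ {w ∈ S | G.Adj v w} | G.Adj u w} ∨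
    (#(G.available L {w ∈ S | ¬ G.Adj v w} c u) : ℝ) ≤ t}

theorem badNeighbors_congr {S : Finset V} {v : V} {d t : ℝ} {c c' : V → ℕ}
    (h : ∀ u ∈ S, ¬ G.Adj v u → c u = c' u) :
    G.badNeighbors L S v d t c = G.badNeighbors L S v d t c' := by
  have : ∀ u, G.available L {w ∈ S | ¬ G.Adj v w} c u =
      G.available L {w ∈ S | ¬ G.Adj v w} c' u :=
    available_congr fun u hu => h u (mem_filter.1 hu).1 (mem_filter.1 hu).2
  simp only [badNeighbors, this]

variable [DecidableEq V] [Fintype V]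

/-- The degree sum `E` allows at most `E / d` neighbours of high degree; each of the at most `Δ`
neighbours is short of colours in a proportion at most `t / l` of the colourings. -/
theorem sum_card_badNeighbors_le {S : Finset V} {v : V} {d t l Δ E : ℝ} (hd : 0 < d) (ht : 0 ≤ t)
    (hl : 0 < l) (hΔ : (#{u ∈ S | G.Adj v u} : ℝ) ≤ Δ)
    (hE : (∑ u ∈ S with G.Adj v u, #{w ∈ {w ∈ S | G.Adj v w} | G.Adj u w} : ℝ) ≤ E)
    (ih : ∀ u ∈ S, l * #(G.partialColorings L (S.erase u)) ≤ #(G.partialColorings L S)) :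
    ∑ c ∈ G.partialColorings L S, (#(G.badNeighbors L S v d t c) : ℝ) ≤
      (E / d + Δ * (t / l)) * #(G.partialColorings L S) := by
  set N : Finset V := {u ∈ S | G.Adj v u} with hN
  set O : Finset V := {w ∈ S | ¬ G.Adj v w} with hO
  have hhigh : (#{u ∈ N | d < #{w ∈ N | G.Adj u w}} : ℝ) ≤ E / d := by
    rw [le_div_iff₀ hd]
    calc _ = ∑ u ∈ N with d < #{w ∈ N | G.Adj u w}, d := by rw [sum_const, nsmul_eq_mul]
      _ ≤ ∑ u ∈ N with d < #{w ∈ N | G.Adj u w}, (#{w ∈ N | G.Adj u w} : ℝ) :=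
          sum_le_sum fun u hu => (mem_filter.1 hu).2.le
      _ ≤ ∑ u ∈ N, (#{w ∈ N | G.Adj u w} : ℝ) :=
          sum_le_sum_of_subset_of_nonneg (filter_subset _ _) fun _ _ _ => by positivity
      _ ≤ E := hE
  have hsmall : ∀ u ∈ N,
      (#{c ∈ G.partialColorings L S | (#(G.available L O c u) : ℝ) ≤ t} : ℝ) ≤
        t / l * #(G.partialColorings L S) := by
    intro u hu
    have huS := (mem_filter.1 hu).1
    have h1 := mul_card_available_le huS hl.le ht (ih u huS)
    have h2 : #{c ∈ G.partialColorings L S | (#(G.available L O c u) : ℝ) ≤ t} ≤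
        #{c ∈ G.partialColorings L S | (#(G.available L (S.erase u) c u) : ℝ) ≤ t} := by
      refine card_le_card (monotone_filter_right _ fun c _ hc => ?_)
      refine le_trans ?_ hc
      refine Nat.cast_le.2 (card_le_card (available_anti (fun w hw => ?_) _ _))
      rw [hO, mem_filter] at hw
      refine mem_erase.2 ⟨?_, hw.1⟩
      rintro rfl
      exact hw.2 (mem_filter.1 hu).2
    rw [div_mul_eq_mul_div, le_div_iff₀ hl, mul_comm]
    refine le_trans ?_ h1
    gcongr
  have hle : ∀ c, (#(G.badNeighbors L S v d t c) : ℝ) ≤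
      #{u ∈ N | d < #{w ∈ N | G.Adj u w}} +
        #{u ∈ N | (#(G.available L O c u) : ℝ) ≤ t} := by
    intro c
    rw [badNeighbors, filter_or]
    exact_mod_cast card_union_le _ _
  calc _ ≤ ∑ c ∈ G.partialColorings L S, ((#{u ∈ N | d < #{w ∈ N | G.Adj u w}} : ℝ) +
        #{u ∈ N | (#(G.available L O c u) : ℝ) ≤ t}) := sum_le_sum fun c _ => hle c
    _ = #(G.partialColorings L S) * #{u ∈ N | d < #{w ∈ N | G.Adj u w}} +
        ∑ u ∈ N, (#{c ∈ G.partialColorings L S | (#(G.available L O c u) : ℝ) ≤ t} : ℝ) := by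
        rw [sum_add_distrib, sum_const, nsmul_eq_mul]
        congr 1
        simp only [card_filter, Nat.cast_sum]
        exact sum_comm
    _ ≤ #(G.partialColorings L S) * (E / d) +
        ∑ u ∈ N, t / l * #(G.partialColorings L S) := by
        gcongr with u hu
        exact hsmall u hu
    _ = (E / d + #N * (t / l)) * #(G.partialColorings L S) := by
        rw [sum_const, nsmul_eq_mul]; ring
    _ ≤ _ := by gcongr

/-- A colouring with few bad neighbours of `v`, recoloured on the other neighbours of `v`, leaves
many colours available at `v` on average. -/
theorem mul_card_extensions_badNeighbors_le {S : Finset V} {v : V} {d t q δ m β Δ : ℝ}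
    {c₀ : V → ℕ} (hq : q ≤ #(L v)) (hdt : 2 * d ≤ t) (hβ : 0 ≤ β) (hm : 0 ≤ m)
    (hΔ : (#{u ∈ S | G.Adj v u} : ℝ) ≤ Δ)
    (hexp : ∀ n : ℝ, t - d ≤ n → Real.exp (-(β / n)) ≤ 1 - 1 / (n - d))
    (hmq : β * Δ ≤ m * ((1 - δ) * q)) (hB : (#(G.badNeighbors L S v d t c₀) : ℝ) ≤ δ * q) :
    (1 - δ) * q * Real.exp (-m) *
        #(G.extensions L S ({w ∈ S | ¬ G.Adj v w} ∪ G.badNeighbors L S v d t c₀) c₀) ≤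
      ∑ c ∈ G.extensions L S ({w ∈ S | ¬ G.Adj v w} ∪ G.badNeighbors L S v d t c₀) c₀,
        (#(G.available L S c v) : ℝ) := by
  set N : Finset V := {u ∈ S | G.Adj v u} with hN
  set O : Finset V := {w ∈ S | ¬ G.Adj v w} with hO
  set B := G.badNeighbors L S v d t c₀ with hBdef
  have hBN : B ⊆ N := filter_subset _ _
  have hTS : O ∪ B ⊆ S :=
    union_subset (filter_subset _ _) (hBN.trans (filter_subset _ _))
  have hA : S \ (O ∪ B) ⊆ N := by
    intro u hu
    simp only [mem_sdiff, mem_union, not_or, hO, mem_filter, not_and, not_not] at hu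
    exact mem_filter.2 ⟨hu.1, hu.2.1 hu.1⟩
  have hgood : ∀ u ∈ S \ (O ∪ B), (#{w ∈ N | G.Adj u w} : ℝ) ≤ d ∧
      t < #(G.available L O c₀ u) := by
    intro u hu
    have huN := hA hu
    have huB : u ∉ B := fun h => (mem_sdiff.1 hu).2 (mem_union_right _ h)
    rw [hBdef, badNeighbors, mem_filter, not_and, not_or, not_lt, not_le] at huB
    exact huB huN
  have hdeg : ∀ u ∈ S \ (O ∪ B), (#{w ∈ S \ (O ∪ B) | G.Adj u w} : ℝ) ≤ d := fun u hu =>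
    le_trans (Nat.cast_le.2 (card_le_card (filter_subset_filter _ hA))) (hgood u hu).1
  -- Fixing `B` as well blocks at most `d` further colours at a good `u`.
  have havail : ∀ u ∈ S \ (O ∪ B), t - d < #(G.available L (O ∪ B) c₀ u) := by
    intro u hu
    have h1 := card_available_le_union (G := G) (L := L) O B c₀ u
    have h2 : #{w ∈ B | G.Adj u w} ≤ #{w ∈ N | G.Adj u w} :=
      card_le_card (filter_subset_filter _ hBN)
    have h3 : (#(G.available L O c₀ u) : ℝ) ≤
        #(G.available L (O ∪ B) c₀ u) + #{w ∈ N | G.Adj u w} := by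
      exact_mod_cast h1.trans (by gcongr)
    have := hgood u hu
    linarith
  have hX : (1 - δ) * q ≤ #(G.available L (O ∪ B) c₀ v) := by
    have h1 := card_available_le_union (G := G) (L := L) O B c₀ v
    have h2 : G.available L O c₀ v = L v := by
      ext x
      simp only [mem_available, hO, mem_filter]
      exact ⟨fun h => h.1, fun h => ⟨h, fun u hu ha => absurd ha hu.2⟩⟩
    have h3 : (#(L v) : ℝ) ≤ #(G.available L (O ∪ B) c₀ v) + #B := by
      rw [h2] at h1
      exact_mod_cast h1.trans (by gcongr; exact filter_subset _ _)
    linarith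
  refine le_trans ?_ (mul_card_extensions_le_sum_available (m := m) hTS hdeg
    (fun u hu => by linarith [havail u hu]) (fun u hu => hexp _ (havail u hu).le) hβ ?_)
  · gcongr
  · have h1 : (#(S \ (O ∪ B)) : ℝ) ≤ #N := Nat.cast_le.2 (card_le_card hA)
    calc β * (#(S \ (O ∪ B)) : ℝ) ≤ β * Δ := by gcongr; linarith
      _ ≤ m * ((1 - δ) * q) := hmq
      _ ≤ _ := by gcongr

/-- The inductive step: adding `v` multiplies the number of colourings by at least `l`. -/
theorem mul_card_partialColorings_le_insert {S : Finset V} {v : V} {d t l q δ m β Δ E : ℝ}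
    (hv : v ∉ S) (hq0 : 0 < δ * q) (hq : q ≤ #(L v)) (hd : 0 < d) (hdt : 2 * d ≤ t) (hl : 0 < l)
    (hβ : 0 ≤ β) (hm : 0 ≤ m) (hΔ : (#{u ∈ S | G.Adj v u} : ℝ) ≤ Δ)
    (hE : (∑ u ∈ S with G.Adj v u, #{w ∈ {w ∈ S | G.Adj v w} | G.Adj u w} : ℝ) ≤ E)
    (hbad : E / d + Δ * (t / l) ≤ δ * q / 2)
    (hexp : ∀ n : ℝ, t - d ≤ n → Real.exp (-(β / n)) ≤ 1 - 1 / (n - d))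
    (hmq : β * Δ ≤ m * ((1 - δ) * q)) (hlq : l ≤ (1 - δ) * q * Real.exp (-m) / 2)
    (ih : ∀ u ∈ S, l * #(G.partialColorings L (S.erase u)) ≤ #(G.partialColorings L S)) :
    l * #(G.partialColorings L S) ≤ #(G.partialColorings L (insert v S)) := by
  set C := G.partialColorings L S with hC
  set O : Finset V := {w ∈ S | ¬ G.Adj v w} with hO
  set B := G.badNeighbors L S v d t with hB
  set A := {c ∈ C | (#(B c) : ℝ) ≤ δ * q} with hA
  -- Markov's inequality for the number of bad neighbours.
  have hhalf : (#C : ℝ) ≤ 2 * #A := by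
    have h1 := sum_card_badNeighbors_le (L := L) hd (by linarith : 0 ≤ t) hl hΔ hE ih
    have h2 : δ * q * #{c ∈ C | ¬ (#(B c) : ℝ) ≤ δ * q} ≤ ∑ c ∈ C, (#(B c) : ℝ) := by
      calc _ = ∑ c ∈ C with ¬ (#(B c) : ℝ) ≤ δ * q, δ * q := by
            rw [sum_const, nsmul_eq_mul, mul_comm]
        _ ≤ ∑ c ∈ C with ¬ (#(B c) : ℝ) ≤ δ * q, (#(B c) : ℝ) :=
            sum_le_sum fun c hc => (not_le.1 (mem_filter.1 hc).2).le
        _ ≤ _ := sum_le_sum_of_subset_of_nonneg (filter_subset _ _) fun _ _ _ => by positivity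
    have h3 : δ * q * #{c ∈ C | ¬ (#(B c) : ℝ) ≤ δ * q} ≤ δ * q * (#C / 2) := by
      calc _ ≤ (E / d + Δ * (t / l)) * #C := h2.trans h1
        _ ≤ δ * q / 2 * #C := by gcongr
        _ = _ := by ring
    have h4 := le_of_mul_le_mul_left h3 hq0
    have h5 : (#A : ℝ) + #{c ∈ C | ¬ (#(B c) : ℝ) ≤ δ * q} = #C := by
      exact_mod_cast card_filter_add_card_filter_not (s := C) fun c => (#(B c) : ℝ) ≤ δ * q
    linarith
  set r : (V → ℕ) → V → ℕ := fun c u => if u ∈ O ∪ B c then c u else 0 with hr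
  -- `B c` depends only on `c` restricted to `O`, so all extensions of the kept colours share one
  -- bad set. Thus `A` splits into full sets of extensions, and resampling stays inside `A`.
  have hfiber : ∀ c₀ ∈ A, {c ∈ A | r c = r c₀} = G.extensions L S (O ∪ B c₀) c₀ := by
    intro c₀ hc₀
    have hBeq : ∀ c, (∀ u ∈ O, c u = c₀ u) → B c = B c₀ := fun c hc =>
      badNeighbors_congr fun u hu ha => hc u (mem_filter.2 ⟨hu, ha⟩)
    ext c
    rw [mem_filter, mem_extensions, ← hC]
    constructor
    · rintro ⟨hcA, hrc⟩
      have hBc : B c = B c₀ := hBeq c fun u hu => by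
        simpa [hr, hu] using congrFun hrc u
      refine ⟨(mem_filter.1 hcA).1, fun u hu => ?_⟩
      have := congrFun hrc u
      simp only [hr, hBc, if_pos hu] at this
      exact this
    · rintro ⟨hcC, hc⟩
      have hBc : B c = B c₀ := hBeq c fun u hu => hc u (mem_union_left _ hu)
      refine ⟨mem_filter.2 ⟨hcC, ?_⟩, ?_⟩
      · rw [hBc]
        exact (mem_filter.1 hc₀).2
      · funext u
        simp only [hr, hBc]
        split_ifs with hu
        · exact hc u hu
        · rfl
  have hgood : (1 - δ) * q * Real.exp (-m) * #A ≤ ∑ c ∈ A, (#(G.available L S c v) : ℝ) := by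
    rw [← sum_fiberwise_of_maps_to (t := A.image r) (fun c hc => mem_image_of_mem r hc),
      card_eq_sum_card_image r A, Nat.cast_sum, mul_sum]
    refine sum_le_sum fun p hp => ?_
    obtain ⟨c₀, hc₀, rfl⟩ := mem_image.1 hp
    rw [hfiber c₀ hc₀]
    exact mul_card_extensions_badNeighbors_le hq hdt hβ hm hΔ hexp hmq (mem_filter.1 hc₀).2
  have hinsert := card_partialColorings_insert (G := G) (L := L) hv (fun _ => True)
    fun _ _ => Iff.rfl
  rw [filter_true, filter_true] at hinsert
  rw [hinsert, Nat.cast_sum]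
  calc l * #C ≤ l * (2 * #A) := by gcongr
    _ ≤ (1 - δ) * q * Real.exp (-m) / 2 * (2 * #A) := by gcongr
    _ = (1 - δ) * q * Real.exp (-m) * #A := by ring
    _ ≤ _ := hgood
    _ ≤ _ := sum_le_sum_of_subset_of_nonneg (filter_subset _ _) fun _ _ _ => by positivity

theorem exists_listColoring_of_sparse_neighborhoods {d t l q δ m β Δ E : ℝ}
    (hq0 : 0 < δ * q) (hq : ∀ v, q ≤ #(L v)) (hd : 0 < d) (hdt : 2 * d ≤ t) (hl : 0 < l)
    (hβ : 0 ≤ β) (hm : 0 ≤ m) (hΔ : ∀ v, (G.degree v : ℝ) ≤ Δ)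
    (hE : ∀ v, (∑ u ∈ G.neighborFinset v, #{w ∈ G.neighborFinset v | G.Adj u w} : ℝ) ≤ E)
    (hbad : E / d + Δ * (t / l) ≤ δ * q / 2)
    (hexp : ∀ n : ℝ, t - d ≤ n → Real.exp (-(β / n)) ≤ 1 - 1 / (n - d))
    (hmq : β * Δ ≤ m * ((1 - δ) * q)) (hlq : l ≤ (1 - δ) * q * Real.exp (-m) / 2) :
    ∃ c : V → ℕ, (∀ v, c v ∈ L v) ∧ ∀ u v, G.Adj u v → c u ≠ c v := by
  have hsub : ∀ (S : Finset V) v, {u ∈ S | G.Adj v u} ⊆ G.neighborFinset v := fun S v u hu => by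
    simpa using (mem_filter.1 hu).2
  have step : ∀ S : Finset V, ∀ v ∉ S,
      l * #(G.partialColorings L S) ≤ #(G.partialColorings L (insert v S)) := by
    intro S
    induction S using Finset.strongInduction with
    | H S ih =>
      intro v hv
      refine mul_card_partialColorings_le_insert hv hq0 (hq v) hd hdt hl hβ hm
        (le_trans (Nat.cast_le.2 (card_le_card (hsub S v))) (hΔ v)) ?_ hbad hexp hmq hlq ?_
      · refine le_trans ?_ (hE v)
        refine le_trans (sum_le_sum fun u _ => Nat.cast_le.2
          (card_le_card (filter_subset_filter _ (hsub S v)))) ?_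
        exact sum_le_sum_of_subset_of_nonneg (hsub S v) fun _ _ _ => by positivity
      · intro u hu
        simpa [insert_erase hu] using ih (S.erase u) (erase_ssubset hu) u (notMem_erase u S)
  have hpos : ∀ S : Finset V, (0 : ℝ) < #(G.partialColorings L S) := by
    intro S
    induction S using Finset.induction_on with
    | empty =>
      have : (fun _ => 0 : V → ℕ) ∈ G.partialColorings L ∅ := by simp [mem_partialColorings]
      exact_mod_cast card_pos.2 ⟨_, this⟩
    | insert v S hv ih => exact lt_of_lt_of_le (by positivity) (step S v hv)
  obtain ⟨c, hc⟩ := card_pos.1 (Nat.cast_pos.1 (hpos univ))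
  rw [mem_partialColorings] at hc
  exact ⟨c, fun v => hc.1 v (mem_univ v), fun u v => hc.2.2 u (mem_univ u) v (mem_univ v)⟩

end Induction

theorem sum_card_filter_adj_neighborFinset {V : Type*} [Fintype V] (G : SimpleGraph V)
    [DecidableRel G.Adj] (v : V) :
    ∑ u ∈ G.neighborFinset v, #{w ∈ G.neighborFinset v | G.Adj u w} =
      2 * (G.induce (G.neighborSet v)).edgeSet.ncard := by
  classical
  have h := (G.induce (G.neighborSet v)).sum_degrees_eq_twice_card_edges
  rw [← coe_edgeFinset, Set.ncard_coe_finset, ← h,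
    sum_subtype (G.neighborFinset v) (p := (· ∈ G.neighborSet v)) (by simp)]
  refine Fintype.sum_congr _ _ fun u => ?_
  rw [← card_neighborFinset_eq_degree, ← card_map (Embedding.subtype _)]
  congr 1
  ext w
  simp [and_comm]

/-! ### Choice of parameters -/

section Parameters

/-- Since `exp y ≥ 1 + y`, the left side is at most `1 - (1 + δ) / (n + 1 + δ)`; the slack `δ`
absorbs the loss of `d` when `n` is large. -/
theorem exp_neg_div_le_one_sub {d δ n : ℝ} (hd : 1 ≤ d) (hδ : 0 < δ) (hδ1 : δ ≤ 1)
    (hn : 4 * d ≤ δ * n) : Real.exp (-((1 + δ) / n)) ≤ 1 - 1 / (n - d) := by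
  have hn0 : 4 * d ≤ n := by nlinarith
  have hnp : 0 < n := by linarith
  have hz : 0 < 1 + (1 + δ) / n := by positivity
  have h1 : Real.exp (-((1 + δ) / n)) ≤ 1 / (1 + (1 + δ) / n) := by
    rw [Real.exp_neg, ← one_div]
    gcongr
    linarith [Real.add_one_le_exp ((1 + δ) / n)]
  refine h1.trans ?_
  have hnd : 0 < n - d := by linarith
  have e : 1 / (1 + (1 + δ) / n) = 1 - (1 + δ) / (n + 1 + δ) := by
    field_simp
    ring
  rw [e, sub_le_sub_iff_left, div_le_div_iff₀ hnd (by linarith)]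
  nlinarith

open Filter in
theorem eventually_log_bounds {δ : ℝ} (hδ : 0 < δ) : ∀ᶠ F : ℝ in atTop,
    1 ≤ Real.log F ∧ 640 * Real.log F ^ 3 ≤ δ ^ 3 * F ^ (2 * δ) ∧ Real.log F ≤ 8 * δ * F := by
  have h1 := Real.tendsto_log_atTop.eventually_ge_atTop 1
  have h2 := (isLittleO_log_rpow_rpow_atTop (3 : ℝ) (by linarith : 0 < 2 * δ)).def
    (show 0 < δ ^ 3 / 640 by positivity)
  have h3 := Real.isLittleO_log_id_atTop.def (show 0 < 8 * δ by positivity)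
  filter_upwards [h1, h2, h3, eventually_gt_atTop 0] with F h1 h2 h3 hF
  refine ⟨h1, ?_, ?_⟩
  · rw [Real.norm_of_nonneg (by positivity), Real.norm_of_nonneg (by positivity)] at h2
    have : Real.log F ^ (3 : ℝ) = Real.log F ^ 3 := by exact_mod_cast Real.rpow_natCast _ 3
    rw [this] at h2
    linarith
  · rw [Real.norm_of_nonneg (by positivity), id, Real.norm_of_nonneg hF.le] at h3
    exact h3

end Parameters

/-- List colouring from lists of size `q`, where every neighbourhood spans at most `Δ ^ 2 / F`
edges and `q` exceeds `Δ / log F` by a constant factor. -/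
theorem exists_listColoring_of_card_edgeSet_le {V : Type*} [Fintype V] (G : SimpleGraph V)
    [DecidableRel G.Adj] {L : V → Finset ℕ} {δ F Δ q : ℝ} (hδ : 0 < δ) (hδ1 : δ ≤ 1 / 16)
    (hF : 1 < F) (hlog : 1 ≤ Real.log F) (hpow : 640 * Real.log F ^ 3 ≤ δ ^ 3 * F ^ (2 * δ))
    (hFΔ : F ≤ Δ) (hdeg : ∀ v, (G.degree v : ℝ) ≤ Δ)
    (hedge : ∀ v, ((G.induce (G.neighborSet v)).edgeSet.ncard : ℝ) ≤ Δ ^ 2 / F)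
    (hq : (1 + 8 * δ) * (Δ / Real.log F) ≤ q) (hL : ∀ v, q ≤ #(L v)) :
    ∃ c : V → ℕ, (∀ v, c v ∈ L v) ∧ ∀ u v, G.Adj u v → c u ≠ c v := by
  classical
  set lam := Real.log F with hlam
  have hF0 : 0 < F := by linarith
  have hΔ0 : 0 < Δ := by linarith
  have hlam0 : 0 < lam := by linarith
  set g := F ^ (2 * δ) with hg
  have hg0 : 0 < g := by positivity
  have ha : 0 < Δ / lam := by positivity
  have hqa : Δ / lam ≤ q := by nlinarith
  have hq0 : 0 < q := by linarith
  -- `d` and `t` make each of the two terms bounding the bad neighbours equal to `δ * (Δ / lam) /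
  -- 4`. `l` comes from `exp (-m) = g / F` with `(1 - δ) * q` weakened to `Δ / lam / 2`.
  set d := 8 * Δ * lam / (δ * F) with hd
  set l := Δ * g / (4 * lam * F) with hl
  set t := δ * l / (4 * lam) with ht
  have hl0 : 0 < l := by positivity
  have hd1 : 1 ≤ d := by
    rw [hd, le_div_iff₀ (by positivity)]
    nlinarith [mul_le_mul hFΔ hlog (by norm_num) hΔ0.le]
  have hdt : 5 * d ≤ δ * t := by
    have e1 : 5 * d = 40 * Δ * lam / (δ * F) := by rw [hd]; ring
    have e2 : δ * t = δ ^ 2 * Δ * g / (16 * lam ^ 2 * F) := by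
      rw [ht, hl]; field_simp; ring
    rw [e1, e2, div_le_div_iff₀ (by positivity) (by positivity)]
    calc _ = Δ * F * (640 * lam ^ 3) := by ring
      _ ≤ Δ * F * (δ ^ 3 * g) := by gcongr
      _ = _ := by ring
  have hexpm : Real.exp (-((1 - 2 * δ) * lam)) = g / F := by
    rw [hg, Real.rpow_def_of_pos hF0, ← hlam, show F = Real.exp lam by rw [hlam, Real.exp_log hF0],
      ← Real.exp_sub]
    ring_nf
  refine exists_listColoring_of_sparse_neighborhoods (G := G) (d := d) (t := t) (l := l) (q := q)
    (δ := δ) (m := (1 - 2 * δ) * lam) (β := 1 + δ) (Δ := Δ) (E := 2 * (Δ ^ 2 / F))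
    (by positivity) hL (by linarith) (by nlinarith) hl0 (by linarith)
    (mul_nonneg (by linarith) hlam0.le) hdeg ?_ ?_ ?_ ?_ ?_
  · intro v
    have h := G.sum_card_filter_adj_neighborFinset v
    have h2 : (∑ u ∈ G.neighborFinset v, #{w ∈ G.neighborFinset v | G.Adj u w} : ℝ) =
        2 * (G.induce (G.neighborSet v)).edgeSet.ncard := by exact_mod_cast h
    rw [h2]
    linarith [hedge v]
  · have e1 : 2 * (Δ ^ 2 / F) / d = δ * (Δ / lam) / 4 := by
      rw [hd]; field_simp; ring
    have e2 : Δ * (t / l) = δ * (Δ / lam) / 4 := by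
      rw [ht]; field_simp
    rw [e1, e2]
    nlinarith
  · intro n hn
    refine exp_neg_div_le_one_sub hd1 hδ (by linarith) ?_
    nlinarith
  -- The excess `8 * δ` pays for the losses in `β`, in `m` and in the colours of bad neighbours.
  · have h1 : 1 + δ ≤ (1 - 2 * δ) * (1 - δ) * (1 + 8 * δ) := by nlinarith [sq_nonneg δ, pow_pos hδ 3]
    have h2 : 0 ≤ (1 - 2 * δ) * (1 - δ) := mul_nonneg (by linarith) (by linarith)
    have h3 : (1 + 8 * δ) * Δ ≤ lam * q := by
      calc _ = lam * ((1 + 8 * δ) * (Δ / lam)) := by field_simp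
        _ ≤ _ := by gcongr
    calc (1 + δ) * Δ ≤ (1 - 2 * δ) * (1 - δ) * (1 + 8 * δ) * Δ := by gcongr
      _ = (1 - 2 * δ) * (1 - δ) * ((1 + 8 * δ) * Δ) := by ring
      _ ≤ (1 - 2 * δ) * (1 - δ) * (lam * q) := by gcongr
      _ = _ := by ring
  · rw [hexpm]
    have e1 : l = (Δ / lam / 2) * (g / F) / 2 := by rw [hl]; field_simp; ring
    rw [e1]
    gcongr
    nlinarith

/-! ### From fixed-size lists to the list chromatic number -/

theorem exists_listChromaticNumber_eq_of_isChoosable {V : Type*} {G : SimpleGraph V} {k : ℕ}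
    (h : G.IsChoosable k) : ∃ n : ℕ, G.listChromaticNumber = n ∧ n ≤ k := by
  have hle : G.listChromaticNumber ≤ k := iInf₂_le k h
  obtain ⟨n, hn⟩ := ENat.ne_top_iff_exists.1 (ne_top_of_le_ne_top (ENat.natCast_ne_top k) hle)
  exact ⟨n, hn.symm, by rw [← hn] at hle; exact_mod_cast hle⟩

theorem isChoosable_of_forall_finset {V : Type*} {G : SimpleGraph V} {k : ℕ}
    (h : ∀ L : V → Finset ℕ, (∀ v, #(L v) = k) →
      ∃ c : V → ℕ, (∀ v, c v ∈ L v) ∧ ∀ u v, G.Adj u v → c u ≠ c v) : G.IsChoosable k := by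
  intro L hL
  choose M hM hMk using fun v => Set.exists_subset_encard_eq (hL v)
  have hfin : ∀ v, (M v).Finite := fun v => Set.finite_of_encard_eq_coe (hMk v)
  obtain ⟨c, hc, hprop⟩ := h (fun v => (hfin v).toFinset) fun v => by
    have := (hfin v).encard_eq_coe_toFinset_card
    rw [hMk v] at this
    exact_mod_cast this.symm
  exact ⟨c, fun v => hM v (by simpa using hc v), hprop⟩

end SimpleGraph

theorem mainTheorem7 (ε : ℝ) (hε : 0 < ε) :
    ∃ f₀ : ℝ, ∀ (V : Type*) [Fintype V] (G : SimpleGraph V) [DecidableRel G.Adj] (f : ℝ),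
      f₀ ≤ f → 1 ≤ f → f ≤ (G.maxDegree : ℝ) ^ 2 + 1 →
      (∀ v : V, ((G.induce (G.neighborSet v)).edgeSet.ncard : ℝ) ≤ (G.maxDegree : ℝ) ^ 2 / f) →
      ∃ k : ℕ, G.listChromaticNumber = k ∧
        (k : ℝ) ≤ (1 + ε) * ((G.maxDegree : ℝ) / Real.log (min (G.maxDegree : ℝ) f)) := by
  set δ : ℝ := min ε 1 / 16 with hδdef
  have hδ : 0 < δ := by positivity
  have hδ1 : δ ≤ 1 / 16 := by linarith [min_le_right ε 1]
  have hδε : 16 * δ ≤ ε := by linarith [min_le_left ε 1]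
  obtain ⟨F₀, hF₀⟩ := Filter.eventually_atTop.1 (SimpleGraph.eventually_log_bounds hδ)
  -- With `f ≤ Δ ^ 2 + 1`, this threshold forces `Δ`, hence `min Δ f`, to be at least `max F₀ 2`.
  refine ⟨max F₀ 2 ^ 2 + 1, fun V _ G _ f hf _ hfΔ hedge => ?_⟩
  set Δ : ℝ := (G.maxDegree : ℝ) with hΔ
  set F := min Δ f with hF
  have h2 : 2 ≤ max F₀ 2 := le_max_right _ _
  have hΔF₀ : max F₀ 2 ≤ Δ :=
    (pow_le_pow_iff_left₀ (by linarith) (by positivity) two_ne_zero).1 (by linarith)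
  have hFF₀ : max F₀ 2 ≤ F := le_min hΔF₀ (by nlinarith)
  have hF2 : 2 ≤ F := h2.trans hFF₀
  have hFΔ : F ≤ Δ := min_le_left _ _
  obtain ⟨hlog, hpow, hlin⟩ := hF₀ F ((le_max_left _ _).trans hFF₀)
  set q : ℕ := ⌊(1 + 16 * δ) * (Δ / Real.log F)⌋₊ with hq
  have ha : 0 ≤ Δ / Real.log F := by positivity
  have hqlow : (1 + 8 * δ) * (Δ / Real.log F) ≤ q := by
    -- Rounding down costs less than `1`, which the spare `8 * δ * (Δ / Real.log F)` covers.
    have h3 := Nat.lt_floor_add_one ((1 + 16 * δ) * (Δ / Real.log F))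
    have h4 : 1 ≤ 8 * δ * (Δ / Real.log F) := by
      rw [mul_div_assoc', le_div_iff₀ (by linarith), one_mul]
      exact hlin.trans (by gcongr)
    rw [← hq] at h3
    linarith
  have hchoose : G.IsChoosable q := SimpleGraph.isChoosable_of_forall_finset fun L hL =>
    G.exists_listColoring_of_card_edgeSet_le hδ hδ1 (by linarith) hlog hpow hFΔ
      (fun v => Nat.cast_le.2 (G.degree_le_maxDegree v))
      (fun v => (hedge v).trans (by gcongr; exact min_le_right _ _)) hqlow
      (fun v => by rw [hL v])
  obtain ⟨k, hk, hkq⟩ := SimpleGraph.exists_listChromaticNumber_eq_of_isChoosable hchoose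
  refine ⟨k, hk, ?_⟩
  calc (k : ℝ) ≤ q := Nat.cast_le.2 hkq
    _ ≤ (1 + 16 * δ) * (Δ / Real.log F) := Nat.floor_le (by positivity)
    _ ≤ _ := by gcongr
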